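/- All graphs are finite and simple. The deck of a graph $G$ is the multiset of its vertex-deleted subgraphs $G-v$, $v\in V(G)$, taken up to isomorphism, and $G$ is reconstructible if every graph with the same deck as $G$ is isomorphic to $G$. Let $\mathrm{diam}(G)$ denote the maximum distance between two vertices of $G$, let $\overline{G}$ denote the complement of $G$, and let the connectivity $\kappa(G)$ be the minimum size of a set $S$ of vertices such that $G-S$ is disconnected or has at most one vertex. Theorem. Every triangle-free graph $G$ with $\mathrm{diam}(G)=\mathrm{diam}(\overline{G})=3$ and $\kappa(G)\ge 3$ is reconstructible. -/

import Mathlib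

universe u

namespace SimpleGraph

/-- The card `G - v`: the induced subgraph on all vertices other than `v`. -/
abbrev card {V : Type u} (G : SimpleGraph V) (v : V) : SimpleGraph ({v}ᶜ : Set V) :=
  G.induce ({v}ᶜ : Set V)

/-- `G` and `H` have the same deck: their multisets of cards, taken up to isomorphism, are equal.
That is, the cards can be matched one-to-one so that matched cards are isomorphic. -/
def SameDeck {V W : Type u} (G : SimpleGraph V) (H : SimpleGraph W) : Prop :=
  ∃ e : V ≃ W, ∀ v : V, Nonempty (G.card v ≃g H.card (e v))

/-- `G` is reconstructible: it is isomorphic to every graph that has the same deck.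
(All graphs with the same deck as a finite graph are finite, so it loses nothing that
`W` ranges over the universe of `V`.) -/
def IsReconstructible {V : Type u} (G : SimpleGraph V) : Prop :=
  ∀ (W : Type u) (H : SimpleGraph W), SameDeck G H → Nonempty (G ≃g H)

/-- The connectivity `κ(G)`: the least size of a set `S` of vertices such that `G - S` is
disconnected or has at most one vertex. The second alternative matters only for
complete graphs, which have no cut set. -/
noncomputable def vertexConnectivity {V : Type u} (G : SimpleGraph V) : ℕ∞ :=
  ⨅ (S : Set V) (_ : ¬ (G.induce Sᶜ).Preconnected ∨ Sᶜ.Subsingleton), S.encard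

end SimpleGraph

/-!
A pair `u`, `v` at distance `3` in `Gᶜ` is an edge of `G` such that every vertex of `G` is adjacent
to `u` or to `v`. As `G` is triangle-free, `G` is therefore bipartite with parts
`N(u) ∋ v` and `N(v) ∋ u`. By symmetry let `|N(v)| ≤ |N(u)|`.

Let `H` have the same deck, and let `H - u'` be the card matched with `G - u`. By Kelly's
counting argument (`degree_eq_of_card_iso`) `u'` has degree `|N(u)|`. Think of `H` as `G - u` with a
new vertex `u'`. If `u'` had a neighbour `p` in `N(u)` and a neighbour `q` in `N(v) \ {u}`, then,
`p` having a neighbour `r ≠ u`, there would be a closed walk `u', p, r, v, q, u'` of length `5`.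
There are at least six vertices, so this odd closed walk lives in some card, although all cards
are bipartite. So the neighbours of `u'` lie on one side, and as
`|N(v) \ {u}| < |N(u)| = deg u'`, they are exactly `N(u)`, whence `G ≅ H`.

Connectivity enters only through the minimum degree: it is at least `3`, which gives both the
neighbour `r` and the six vertices.
-/

namespace SimpleGraph

variable {V W : Type u}

/-! ### Counting edges in the deck -/

theorem card_edgeFinset_card_add_degree [Fintype V] [DecidableEq V] (G : SimpleGraph V)
    [DecidableRel G.Adj] (v : V) :
    (G.card v).edgeFinset.card + G.degree v = G.edgeFinset.card := by
  have h1 := G.card_edgeFinset_induce_compl_singleton v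
  rw [card_edgeFinset_deleteIncidenceSet] at h1
  have h2 : G.degree v ≤ G.edgeFinset.card := by
    rw [← G.card_incidenceFinset_eq_degree]
    exact Finset.card_le_card (G.incidenceFinset_subset v)
  have h3 : (G.card v).edgeFinset.card = (G.induce ({v}ᶜ : Set V)).edgeFinset.card := by
    congr!
  omega

/-- Kelly's lemma for edges: an edge survives in all cards but the two at its ends. -/
theorem sum_card_edgeFinset_card_add [Fintype V] [DecidableEq V] (G : SimpleGraph V)
    [DecidableRel G.Adj] :
    ∑ v, (G.card v).edgeFinset.card + 2 * G.edgeFinset.card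
      = Fintype.card V * G.edgeFinset.card := by
  rw [← G.sum_degrees_eq_twice_card_edges, ← Finset.sum_add_distrib]
  simp [card_edgeFinset_card_add_degree]

open Classical in
/-- The degree of a deleted vertex can be read off the deck. -/
theorem degree_eq_of_card_iso [Fintype V] [Fintype W] {G : SimpleGraph V} {H : SimpleGraph W}
    (hV : 3 ≤ Fintype.card V) (e : V ≃ W) (he : ∀ v, Nonempty (G.card v ≃g H.card (e v)))
    (v : V) : G.degree v = H.degree (e v) := by
  have hc (w : V) : (G.card w).edgeFinset.card = (H.card (e w)).edgeFinset.card :=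
    (he w).some.card_edgeFinset_eq
  have hG := G.sum_card_edgeFinset_card_add
  have hH := H.sum_card_edgeFinset_card_add
  rw [← e.sum_comp, ← Fintype.card_congr e] at hH
  simp only [hc] at hG
  have hE : G.edgeFinset.card = H.edgeFinset.card := by
    obtain ⟨k, hk⟩ := Nat.exists_eq_add_of_le hV
    rw [hk] at hG hH
    have : (k + 1) * G.edgeFinset.card = (k + 1) * H.edgeFinset.card := by linarith
    exact Nat.eq_of_mul_eq_mul_left (Nat.succ_pos k) this
  have hG' := G.card_edgeFinset_card_add_degree v
  have hH' := H.card_edgeFinset_card_add_degree (e v)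
  have := hc v
  omega

/-! ### Connectivity and diameter -/

/-- Deleting the neighbours of `a` isolates `a` or leaves nothing else, so the minimum degree is at
least the connectivity. -/
theorem vertexConnectivity_le_encard_neighborSet (G : SimpleGraph V) (a : V) :
    G.vertexConnectivity ≤ (G.neighborSet a).encard := by
  refine iInf₂_le _ ?_
  by_contra! h
  obtain ⟨hp, hs⟩ := h
  have ha : a ∈ (G.neighborSet a)ᶜ := by simp
  obtain ⟨b, hb, hba⟩ := hs.exists_ne a
  have : Nontrivial ((G.neighborSet a)ᶜ : Set V) :=
    ⟨⟨b, hb⟩, ⟨a, ha⟩, by simpa using hba⟩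
  obtain ⟨c, hc⟩ := hp.exists_adj_of_nontrivial ⟨a, ha⟩
  exact c.2 hc

/-- The ends of the edge have distance `3` in the complement, hence no common neighbour there. -/
theorem exists_dominating_edge {G : SimpleGraph V} (h : Gᶜ.diam = 3) :
    ∃ u v, G.Adj u v ∧ ∀ w, G.Adj u w ∨ G.Adj v w := by
  have : Nontrivial V := nontrivial_of_diam_ne_zero (G := Gᶜ) (by omega)
  obtain ⟨u, v, huv⟩ := Gᶜ.exists_dist_eq_diam
  rw [h] at huv
  have hne : u ≠ v := by
    rintro rfl
    simp at huv
  have hadj : G.Adj u v := by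
    by_contra hn
    have := dist_eq_one_iff_adj.mpr ((G.compl_adj u v).mpr ⟨hne, hn⟩)
    omega
  refine ⟨u, v, hadj, fun w ↦ ?_⟩
  by_contra! hw
  have huw : u ≠ w := by
    rintro rfl
    exact hw.2 hadj.symm
  have hvw : v ≠ w := by
    rintro rfl
    exact hw.1 hadj
  have h1 : Gᶜ.Adj u w := ⟨huw, hw.1⟩
  have h2 : Gᶜ.Adj w v := ⟨hvw.symm, fun h ↦ hw.2 h.symm⟩
  have := dist_le (h1.toWalk.append h2.toWalk)
  simp at this
  omega

/-- In a triangle-free graph, the sides of a dominating edge `uv` are `N(u)` and `N(v)`. -/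
theorem colorable_two_of_dominating_edge {G : SimpleGraph V} (htri : G.CliqueFree 3) {u v : V}
    (hdom : ∀ w, G.Adj u w ∨ G.Adj v w) : G.Colorable 2 := by
  classical
  have ht {a b c : V} (hab : G.Adj a b) (hac : G.Adj a c) (hbc : G.Adj b c) : False :=
    htri {a, b, c} (is3Clique_triple_iff.mpr ⟨hab, hac, hbc⟩)
  refine (Coloring.mk (fun w ↦ decide (G.Adj u w)) ?_ : G.Coloring Bool).colorable
  intro x y hxy heq
  have hiff : G.Adj u x ↔ G.Adj u y := by simpa using heq
  by_cases hx : G.Adj u x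
  · exact ht hx (hiff.mp hx) hxy
  · exact ht ((hdom x).resolve_left hx) ((hdom y).resolve_left fun h ↦ hx (hiff.mpr h)) hxy

/-! ### Reattaching the deleted vertex -/

/-- A card isomorphism extends to a bijection that matches the deleted vertices. -/
theorem exists_equiv_of_card_iso {G : SimpleGraph V} {H : SimpleGraph W} {u : V} {u' : W}
    (φ : G.card u ≃g H.card u') :
    ∃ f : V ≃ W, f u = u' ∧ ∀ x y, x ≠ u → y ≠ u → (H.Adj (f x) (f y) ↔ G.Adj x y) := by
  classical
  let f : V ≃ W := (Equiv.Set.sumCompl {u}).symm.trans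
    ((Equiv.sumCongr (Equiv.ofUnique ({u} : Set V) ({u'} : Set W)) φ.toEquiv).trans
      (Equiv.Set.sumCompl {u'}))
  have hf (x : V) (hx : x ≠ u) : f x = φ ⟨x, hx⟩ := by
    have : (Equiv.Set.sumCompl {u}).symm x = Sum.inr ⟨x, hx⟩ :=
      Equiv.Set.sumCompl_symm_apply_of_notMem (s := {u}) hx
    simp [f, this]
  refine ⟨f, ?_, fun x y hx hy ↦ ?_⟩
  · have : (Equiv.Set.sumCompl {u}).symm u = Sum.inl ⟨u, rfl⟩ :=
      Equiv.Set.sumCompl_symm_apply_of_mem (s := {u}) rfl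
    simp only [f, Equiv.trans_apply, this]
    simp
  · rw [hf x hx, hf y hy]
    exact φ.map_adj_iff (v := ⟨x, hx⟩) (w := ⟨y, hy⟩)

/-- With at least six vertices, a closed walk of length `5` (vertices may repeat) avoids some
vertex, so it cannot occur if all cards are bipartite. -/
theorem false_of_closed_walk_five [Fintype V] {G : SimpleGraph V} (hV : 6 ≤ Fintype.card V)
    (hcol : ∀ x, (G.card x).Colorable 2) {a b c d e : V} (hab : G.Adj a b) (hbc : G.Adj b c)
    (hcd : G.Adj c d) (hde : G.Adj d e) (hea : G.Adj e a) : False := by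
  classical
  obtain ⟨x, hx⟩ : ∃ x, x ∉ ({a, b, c, d, e} : Finset V) := by
    by_contra! h
    have h1 : Fintype.card V ≤ ({a, b, c, d, e} : Finset V).card :=
      Finset.card_le_card fun y _ ↦ h y
    have h2 : ({a, b, c, d, e} : Finset V).card ≤ 5 := Finset.card_le_five
    omega
  simp only [Finset.mem_insert, Finset.mem_singleton, not_or] at hx
  obtain ⟨ha, hb, hc, hd, he⟩ := hx
  obtain ⟨C⟩ := hcol x
  have key {y z : V} (hy : ¬x = y) (hz : ¬x = z) (h : G.Adj y z) :
      C ⟨y, fun t ↦ hy t.symm⟩ ≠ C ⟨z, fun t ↦ hz t.symm⟩ := C.valid h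
  have h1 := key ha hb hab
  have h2 := key hb hc hbc
  have h3 := key hc hd hcd
  have h4 := key hd he hde
  have h5 := key he ha hea
  omega

open Classical in
/-- `K` differs from `G` only at `u`, and `u` is on the larger side `N(u)` of the dominating edge
`uv`: then bipartite cards and the degree of `u` force `K = G`. -/
theorem eq_of_eq_off_vertex [Fintype V] {G K : SimpleGraph V} {u v : V} (hV : 6 ≤ Fintype.card V)
    (hdom : ∀ w, G.Adj u w ∨ G.Adj v w) (huv : G.Adj u v)
    (hle : G.degree v ≤ G.degree u) (hmin : ∀ w, 2 ≤ G.degree w)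
    (hcol : ∀ x, (K.card x).Colorable 2) (hdeg : K.degree u = G.degree u)
    (hK : ∀ x y, x ≠ u → y ≠ u → (K.Adj x y ↔ G.Adj x y))
    (hbip : ∀ w x, G.Adj u w → G.Adj w x → G.Adj v x) : K = G := by
  have hsub : K.neighborFinset u ⊆ G.neighborFinset u := by
    intro q hq
    rw [mem_neighborFinset] at hq ⊢
    by_contra hqu
    have hvq := (hdom q).resolve_left hqu
    -- `N_K(u)` cannot lie inside `N(v) \ {u}`, which is too small.
    obtain ⟨p, hp, hpv⟩ : ∃ p, K.Adj u p ∧ G.Adj u p := by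
      by_contra! hall
      have hss : K.neighborFinset u ⊆ (G.neighborFinset v).erase u := by
        intro p hp
        rw [mem_neighborFinset] at hp
        rw [Finset.mem_erase, mem_neighborFinset]
        exact ⟨hp.ne', (hdom p).resolve_left (hall p hp)⟩
      have h1 := Finset.card_le_card hss
      rw [Finset.card_erase_of_mem (by simpa using huv.symm)] at h1
      simp only [card_neighborFinset_eq_degree] at h1
      have := hmin u
      omega
    obtain ⟨r, hr, hru⟩ : ∃ r ∈ G.neighborFinset p, r ≠ u :=
      Finset.exists_mem_ne (by simpa [Nat.lt_iff_add_one_le] using hmin p) u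
    rw [mem_neighborFinset] at hr
    have hrv : G.Adj r v := (hbip p r hpv hr).symm
    exact false_of_closed_walk_five hV hcol hp ((hK _ _ hpv.ne' hru).mpr hr)
      ((hK _ _ hru huv.ne').mpr hrv) ((hK _ _ huv.ne' hq.ne').mpr hvq) hq.symm
  have heq := Finset.eq_of_subset_of_card_le hsub (by simp [hdeg])
  have hu (x : V) : K.Adj u x ↔ G.Adj u x := by
    rw [← mem_neighborFinset, heq, mem_neighborFinset]
  ext x y
  by_cases hx : x = u
  · rw [hx, hu]
  by_cases hy : y = u
  · rw [hy, K.adj_comm, G.adj_comm, hu]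
  exact hK x y hx hy

/-! ### Reconstruction -/

open Classical in
/-- A triangle-free graph of minimum degree at least `3` with a dominating edge is reconstructible
from the card at the end of larger degree. -/
theorem isReconstructible_of_dominating_edge [Fintype V] {G : SimpleGraph V}
    (htri : G.CliqueFree 3) (hmin : ∀ w, 3 ≤ G.degree w) {u v : V} (huv : G.Adj u v)
    (hdom : ∀ w, G.Adj u w ∨ G.Adj v w) (hle : G.degree v ≤ G.degree u) :
    G.IsReconstructible := by
  rintro W H ⟨e, he⟩
  have ht {a b c : V} (hab : G.Adj a b) (hac : G.Adj a c) (hbc : G.Adj b c) : False :=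
    htri {a, b, c} (is3Clique_triple_iff.mpr ⟨hab, hac, hbc⟩)
  have hV : 6 ≤ Fintype.card V := by
    have hdisj : Disjoint (G.neighborFinset u) (G.neighborFinset v) := by
      rw [Finset.disjoint_left]
      intro w h1 h2
      rw [mem_neighborFinset] at h1 h2
      exact ht huv h1 h2
    have h1 := Finset.card_le_univ (G.neighborFinset u ∪ G.neighborFinset v)
    rw [Finset.card_union_of_disjoint hdisj] at h1
    simp only [card_neighborFinset_eq_degree] at h1
    have := hmin u
    have := hmin v
    omega
  let _ : Fintype W := Fintype.ofEquiv V e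
  have hdeg := degree_eq_of_card_iso (by omega) e he u
  obtain ⟨f, hfu, hf⟩ := exists_equiv_of_card_iso (he u).some
  have hG2 := colorable_two_of_dominating_edge htri hdom
  have hHcol (y : W) : (H.card y).Colorable 2 := by
    obtain ⟨x, rfl⟩ := e.surjective y
    have hc : (G.card x).Colorable 2 := hG2.of_hom (Embedding.induce _).toHom
    exact hc.of_hom (he x).some.symm.toHom
  let ψ : H.comap f ≃g H := Iso.comap f H
  have hKcol (x : V) : ((H.comap f).card x).Colorable 2 := by
    let g (y : ({x}ᶜ : Set V)) : ({f x}ᶜ : Set W) := ⟨f y, fun h ↦ y.2 (f.injective h)⟩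
    exact (hHcol (f x)).of_hom (⟨g, fun h ↦ h⟩ : (H.comap f).card x →g H.card (f x))
  have hK : H.comap f = G := by
    refine eq_of_eq_off_vertex hV hdom huv hle (fun w ↦ (hmin w).trans' (by norm_num)) hKcol ?_
      hf fun w x hw hx ↦ (hdom x).resolve_left fun h ↦ ht hw h hx
    rw [hdeg, ← hfu]
    exact (ψ.degree_eq u).symm
  rw [← hK]
  exact ⟨ψ⟩

end SimpleGraph

theorem theorem5 {V : Type u} [Finite V] (G : SimpleGraph V)
    (hdiam : G.diam = 3) (hdiam_compl : Gᶜ.diam = 3)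
    (htri : G.CliqueFree 3) (hconn : 3 ≤ G.vertexConnectivity) :
    G.IsReconstructible := by
  classical
  have := Fintype.ofFinite V
  have hmin (w : V) : 3 ≤ G.degree w := by
    have h := hconn.trans (G.vertexConnectivity_le_encard_neighborSet w)
    rw [← G.coe_neighborFinset, Set.encard_coe_eq_coe_finsetCard,
      SimpleGraph.card_neighborFinset_eq_degree] at h
    exact_mod_cast h
  obtain ⟨u, v, huv, hdom⟩ := SimpleGraph.exists_dominating_edge hdiam_compl
  rcases le_total (G.degree v) (G.degree u) with hle | hle
  · exact SimpleGraph.isReconstructible_of_dominating_edge htri hmin huv hdom hle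
  · exact SimpleGraph.isReconstructible_of_dominating_edge htri hmin huv.symm
      (fun w ↦ (hdom w).symm) hle
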